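/- All rings are commutative with identity. For a ring $R$, let $R(X)=\Sigma_R^{-1}R[X]$ be its Nagata ring, where $\Sigma_R$ is the multiplicatively closed set of all $p\in R[X]$ whose coefficients generate the unit ideal of $R$; a ring homomorphism $R\to S$ induces a ring homomorphism $R(X)\to S(X)$ fixing $X$. A ring extension $R\subseteq S$ (that is, an injective ring homomorphism $R\to S$) is called Prüfer if for every intermediate ring $R\subseteq T\subseteq S$ the map $R\to T$ is a flat epimorphism of rings. It is called quasi-Prüfer if there is an intermediate ring $R\subseteq R'\subseteq S$ such that $R\subseteq R'$ is integral and $R'\subseteq S$ is Prüfer. Theorem. Let $R\subseteq S$ be a ring extension, and let $\overline R$ be the integral closure of $R$ in $S$. (1) $R\subseteq S$ is Prüfer if and only if $R(X)\to S(X)$ is a Prüfer extension. (2) $R\subseteq S$ is quasi-Prüfer if and only if $R(X)\to S(X)$ is a quasi-Prüfer extension. (3) If $R\subseteq S$ is Prüfer or quasi-Prüfer, then the canonical map $\overline R(X)\to S(X)$ is injective and its image is the integral closure of $R(X)$ in $S(X)$; moreover the canonical ring homomorphisms $\overline R\otimes_R R(X)\to\overline R(X)$ and $S\otimes_R R(X)\to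 S(X)$ are isomorphisms. -/

import Mathlib

open Polynomial
open scoped TensorProduct

noncomputable section

/-! ### Prüfer and quasi-Prüfer extensions -/

/-- The `R`-algebra `S` is a Prüfer extension of `R`: `R → S` is injective, and for every
intermediate ring `R ⊆ T ⊆ S`, the ring map `R → T` is a flat epimorphism. -/
structure IsPruferExtension (R S : Type*) [CommRing R] [CommRing S] [Algebra R S] : Prop where
  injective : Function.Injective (algebraMap R S)
  flat : ∀ T : Subalgebra R S, Module.Flat R T
  epi : ∀ T : Subalgebra R S, Algebra.IsEpi R T

/-- The `R`-algebra `S` is a quasi-Prüfer extension of `R`: `R → S` is injective and factors as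
`R ⊆ R' ⊆ S` with `R ⊆ R'` integral and `R' ⊆ S` Prüfer. -/
structure IsQuasiPruferExtension (R S : Type*) [CommRing R] [CommRing S] [Algebra R S] :
    Prop where
  injective : Function.Injective (algebraMap R S)
  exists_factorization :
    ∃ R' : Subalgebra R S, Algebra.IsIntegral R R' ∧ IsPruferExtension R' S

/-! ### Nagata rings -/

/-- The multiplicatively closed set of the polynomials over `R` whose content is the unit ideal. -/
def unitContent (R : Type*) [CommRing R] : Submonoid R[X] where
  carrier := {p | p.contentIdeal = ⊤}
  one_mem' := contentIdeal_one
  mul_mem' hp hq := contentIdeal_mul_eq_top_of_contentIdeal_eq_top hp hq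

/-- The Nagata ring `R(X)`: the localization of `R[X]` at the polynomials of unit content. -/
def NagataRing (R : Type*) [CommRing R] : Type _ := Localization (unitContent R)

namespace NagataRing

instance (R : Type*) [CommRing R] : CommRing (NagataRing R) :=
  inferInstanceAs (CommRing (Localization (unitContent R)))

instance (R : Type*) [CommRing R] {A : Type*} [CommSemiring A] [Algebra A R[X]] :
    Algebra A (NagataRing R) :=
  inferInstanceAs (Algebra A (Localization (unitContent R)))

instance (R : Type*) [CommRing R] {A B : Type*} [CommSemiring A] [CommSemiring B]
    [Algebra A R[X]] [Algebra B R[X]] [SMul A B] [IsScalarTower A B R[X]] :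
    IsScalarTower A B (NagataRing R) :=
  inferInstanceAs (IsScalarTower A B (Localization (unitContent R)))

instance (R : Type*) [CommRing R] : IsLocalization (unitContent R) (NagataRing R) :=
  inferInstanceAs (IsLocalization (unitContent R) (Localization (unitContent R)))

variable (R S : Type*) [CommRing R] [CommRing S] [Algebra R S]

theorem unitContent_le_comap :
    unitContent R ≤ (unitContent S).comap (mapRingHom (algebraMap R S)) := by
  intro p hp
  have hp' : p.contentIdeal = ⊤ := hp
  change (p.map (algebraMap R S)).contentIdeal = ⊤
  rw [contentIdeal_map_eq_map_contentIdeal, hp', Ideal.map_top]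

/-- The ring map `R(X) → S(X)` induced by `R → S`, fixing `X`. -/
def map : NagataRing R →+* NagataRing S :=
  IsLocalization.map (NagataRing S) (mapRingHom (algebraMap R S)) (unitContent_le_comap R S)

theorem map_algebraMap (p : R[X]) :
    map R S (algebraMap R[X] (NagataRing R) p) =
      algebraMap S[X] (NagataRing S) (p.map (algebraMap R S)) :=
  IsLocalization.map_eq _ p

/-- `S(X)` as an `R(X)`-algebra through the canonical map `R(X) → S(X)`. -/
@[reducible] def algebra : Algebra (NagataRing R) (NagataRing S) := (map R S).toAlgebra

/-- The canonical map `R(X) → S(X)` as a map of `R`-algebras. -/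
def mapAlgHom : NagataRing R →ₐ[R] NagataRing S :=
  { map R S with
    commutes' := fun r => by
      change map R S (algebraMap R (NagataRing R) r) = algebraMap R (NagataRing S) r
      rw [IsScalarTower.algebraMap_apply R R[X] (NagataRing R), map_algebraMap,
        IsScalarTower.algebraMap_apply R S[X] (NagataRing S)]
      simp [Polynomial.algebraMap_apply] }

/-- The canonical map `S ⊗[R] R(X) → S(X)`, sending `s ⊗ z` to `s` times the image of `z`. -/
def tensorMap : S ⊗[R] NagataRing R →ₐ[S] NagataRing S :=
  Algebra.TensorProduct.lift (Algebra.ofId S (NagataRing S)) (mapAlgHom R S)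
    fun _ _ => Commute.all _ _

theorem tensorMap_tmul (s : S) (z : NagataRing R) :
    tensorMap R S (s ⊗ₜ z) = algebraMap S (NagataRing S) s * map R S z := rfl

end NagataRing

end

noncomputable section

/-! ### Polynomials of unit content -/

/-! Both properties are turned into conditions on single elements, which can be carried between `R`
and `R(X)` by clearing denominators. Write `(R : x)` for the ideal of denominators of `x`. An
extension is Prüfer iff `(R : x) + x (R : x) = R` for every `x` in `S`, that is, `1 = a + b x` with
`a x` in `R`; then `b x = 1 - a` is in `R` automatically. It is quasi-Prüfer iff every `x` is a root
of a polynomial over `R` of unit content. The bridge is `coeff_mem_fractionProductIdeal`: over an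
integrally closed base, the coefficients of any polynomial vanishing at `x` lie in `(R : x) + x (R :
x)`.

To compare Nagata rings, elements of `S(X)` must have denominators over `R`: each `g` of unit
content over `S` has to divide some `p` of unit content over `R` (`UnitContentDominates`). This
holds for integral extensions by lying over and incomparability, for Prüfer ones by common
denominators, hence for quasi-Prüfer ones. It makes `S(X)` a localization of `S[X]` at polynomials
from `R[X]`, which gives the tensor product isomorphisms. Unit content is always produced prime by
prime: an ideal of `R[X]` contained in no `m[X]`, with `m` maximal, contains such a polynomial. -/

theorem Polynomial.contentIdeal_le_iff {R : Type*} [CommRing R] {p : R[X]} {I : Ideal R} :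
    p.contentIdeal ≤ I ↔ ∀ n, p.coeff n ∈ I := by
  refine ⟨fun h n => h (p.coeff_mem_contentIdeal n), fun h => ?_⟩
  rw [contentIdeal_def, Ideal.span_le]
  intro r hr
  obtain ⟨n, -, rfl⟩ := mem_coeffs_iff.1 (Finset.mem_coe.1 hr)
  exact h n

/-- An ideal of `R[X]` contained in no `m[X]` contains a polynomial of unit content. -/
theorem Polynomial.exists_mem_contentIdeal_eq_top {R : Type*} [CommRing R] (A : Ideal R[X])
    (h : ∀ m : Ideal R, m.IsMaximal → ∃ u ∈ A, ∃ n, u.coeff n ∉ m) :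
    ∃ u ∈ A, u.contentIdeal = ⊤ := by
  have hdir : Directed (· ≤ ·) fun u : A => (u : R[X]).contentIdeal := by
    intro u v
    -- The shift by `natDegree + 1` keeps the coefficients of `u` and `v` apart, so the contents of
    -- members of the ideal form a directed family.
    refine ⟨⟨(u : R[X]) + X ^ ((u : R[X]).natDegree + 1) * (v : R[X]),
      A.add_mem u.2 (A.mul_mem_left _ v.2)⟩, ?_⟩
    have hu : ∀ n, (u : R[X]).coeff n ∈
        ((u : R[X]) + X ^ ((u : R[X]).natDegree + 1) * (v : R[X])).contentIdeal := by
      intro n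
      by_cases hn : n ≤ (u : R[X]).natDegree
      · have := coeff_mem_contentIdeal
          ((u : R[X]) + X ^ ((u : R[X]).natDegree + 1) * (v : R[X])) n
        rwa [coeff_add, coeff_X_pow_mul', if_neg (by omega), add_zero] at this
      · rw [coeff_eq_zero_of_natDegree_lt (by omega)]
        exact zero_mem _
    refine ⟨contentIdeal_le_iff.2 hu, contentIdeal_le_iff.2 fun n => ?_⟩
    have := coeff_mem_contentIdeal
      ((u : R[X]) + X ^ ((u : R[X]).natDegree + 1) * (v : R[X])) (n + ((u : R[X]).natDegree + 1))
    rw [coeff_add, coeff_X_pow_mul] at this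
    exact (Ideal.add_mem_iff_right _ (hu _)).1 this
  have htop : (⨆ u : A, (u : R[X]).contentIdeal) = ⊤ := by
    by_contra hne
    obtain ⟨m, hm, hle⟩ := Ideal.exists_le_maximal _ hne
    obtain ⟨u, hu, n, hn⟩ := h m hm
    exact hn (hle (le_iSup (fun u : A => (u : R[X]).contentIdeal) ⟨u, hu⟩
      (coeff_mem_contentIdeal u n)))
  obtain ⟨u, hu⟩ := (Submodule.mem_iSup_of_directed _ hdir).1
    (htop ▸ Submodule.mem_top : (1 : R) ∈ ⨆ u : A, (u : R[X]).contentIdeal)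
  exact ⟨u, u.2, (Ideal.eq_top_iff_one _).2 hu⟩

/-- By McCoy, a zero divisor is killed by a nonzero constant, which then annihilates the whole
content. -/
theorem Polynomial.mem_nonZeroDivisors_of_contentIdeal_eq_top {R : Type*} [CommRing R] {p : R[X]}
    (hp : p.contentIdeal = ⊤) : p ∈ nonZeroDivisors R[X] := by
  by_contra h
  obtain ⟨a, ha, hap⟩ := notMem_nonZeroDivisors_iff.1 h
  have : p.contentIdeal ≤ (⊥ : Ideal R).colon {a} :=
    contentIdeal_le_iff.2 fun n => by
      rw [Submodule.mem_colon_singleton, Ideal.mem_bot, smul_eq_mul, mul_comm, ← smul_eq_mul,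
        ← coeff_smul, hap, coeff_zero]
  rw [hp, top_le_iff, Ideal.eq_top_iff_one, Submodule.mem_colon_singleton] at this
  exact ha (by simpa using this)

/-! ### The ideals of denominators -/

section RingHom

variable {A B : Type*} [CommRing A] [CommRing B]

/-- The ideal of those `a` such that `a x` lies in the image of `A`. -/
def denomIdeal (φ : A →+* B) (x : B) : Ideal A where
  carrier := {a | φ a * x ∈ φ.range}
  zero_mem' := ⟨0, by simp⟩
  add_mem' ha hb := by
    simp only [Set.mem_ofPred_eq, map_add, add_mul] at *
    exact add_mem ha hb
  smul_mem' c a ha := by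
    simp only [Set.mem_ofPred_eq, smul_eq_mul, map_mul, mul_assoc] at *
    exact mul_mem ⟨c, rfl⟩ ha

/-- The ideal `(A : x) + x (A : x)`. -/
def fractionProductIdeal (φ : A →+* B) (x : B) : Ideal A where
  carrier := {r | ∃ a ∈ denomIdeal φ x, ∃ b, φ r = φ a + φ b * x}
  zero_mem' := ⟨0, zero_mem _, 0, by simp⟩
  add_mem' := by
    rintro r s ⟨a, ha, b, h⟩ ⟨a', ha', b', h'⟩
    exact ⟨a + a', add_mem ha ha', b + b', by simp only [map_add, h, h']; ring⟩
  smul_mem' := by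
    rintro c r ⟨a, ha, b, h⟩
    exact ⟨c * a, Ideal.mul_mem_left _ _ ha, c * b, by simp only [smul_eq_mul, map_mul, h]; ring⟩

theorem denomIdeal_le_fractionProductIdeal (φ : A →+* B) (x : B) :
    denomIdeal φ x ≤ fractionProductIdeal φ x := fun a ha => ⟨a, ha, 0, by simp⟩

theorem mem_fractionProductIdeal_of_eq_mul {φ : A →+* B} {x : B} {r b : A} (h : φ r = φ b * x) :
    r ∈ fractionProductIdeal φ x := ⟨0, zero_mem _, b, by simp [h]⟩

/-- Every `x` in `B` satisfies `(A : x) + x (A : x) = A`. -/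
def IsFractionInvertible (φ : A →+* B) : Prop := ∀ x, 1 ∈ fractionProductIdeal φ x

theorem IsFractionInvertible.of_comp {C : Type*} [CommRing C] {φ : A →+* B} {ψ : B →+* C}
    (h : IsFractionInvertible (ψ.comp φ)) : IsFractionInvertible ψ := by
  intro x
  obtain ⟨a, ⟨c, hc⟩, b, hb⟩ := h x
  exact ⟨φ a, ⟨φ c, hc⟩, φ b, by simpa using hb⟩

theorem IsFractionInvertible.of_comp_injective {C : Type*} [CommRing C] {φ : A →+* B}
    {ψ : B →+* C} (hψ : Function.Injective ψ) (h : IsFractionInvertible (ψ.comp φ)) :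
    IsFractionInvertible φ := by
  intro x
  obtain ⟨a, ⟨c, hc⟩, b, hb⟩ := h (ψ x)
  exact ⟨a, ⟨c, hψ (by simpa using hc)⟩, b, hψ (by simpa using hb)⟩

/-- If the image of `A` is integrally closed, then a polynomial relation for `x` has its
coefficients in `(A : x) + x (A : x)`. -/
theorem coeff_mem_fractionProductIdeal {φ : A →+* B}
    (hφ : ∀ y, φ.IsIntegralElem y → y ∈ φ.range) (x : B) (f : A[X]) (hf : f.eval₂ φ x = 0)
    (k : ℕ) : f.coeff k ∈ fractionProductIdeal φ x := by
  suffices H : ∀ n, ∀ f : A[X], f.natDegree ≤ n → f.eval₂ φ x = 0 →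
      ∀ k, f.coeff k ∈ fractionProductIdeal φ x from H _ f le_rfl hf k
  clear k hf f
  intro n
  induction n with
  | zero =>
    intro f hn hf k
    rw [eq_C_of_natDegree_le_zero hn] at hf ⊢
    rw [eval₂_C] at hf
    rw [coeff_C]
    split_ifs
    · exact mem_fractionProductIdeal_of_eq_mul (b := 0) (by simp [hf])
    · exact zero_mem _
  | succ n ih =>
    intro f hn hf k
    rcases hn.lt_or_eq with hn | hn
    · exact ih f (by omega) hf k
    -- Leading coefficient times `x` is integral, hence comes from some `b`. Trading the leading
    -- term for `b X ^ n` keeps the root and lowers the degree.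
    obtain ⟨b, hb⟩ := hφ _ (φ.isIntegralElem_leadingCoeff_mul f x hf)
    have hlead : f.leadingCoeff ∈ fractionProductIdeal φ x :=
      denomIdeal_le_fractionProductIdeal φ x ⟨b, hb⟩
    have hbK : b ∈ fractionProductIdeal φ x := mem_fractionProductIdeal_of_eq_mul hb
    have hsplit : f = f.eraseLead + C f.leadingCoeff * X ^ (n + 1) := by
      rw [← hn, eraseLead_add_C_mul_X_pow]
    have hroot : (f.eraseLead + C b * X ^ n).eval₂ φ x = 0 := by
      rw [hsplit] at hf
      simp only [eval₂_add, eval₂_mul, eval₂_C, eval₂_X_pow] at hf ⊢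
      rw [hb, ← hf]
      ring
    have hdeg : (f.eraseLead + C b * X ^ n).natDegree ≤ n := by
      refine natDegree_add_le_of_degree_le ?_ (natDegree_C_mul_X_pow_le b n)
      have := eraseLead_natDegree_le f
      omega
    have hk := ih _ hdeg hroot k
    have hg : f.eraseLead.coeff k ∈ fractionProductIdeal φ x := by
      rw [coeff_add, coeff_C_mul_X_pow] at hk
      refine (Ideal.add_mem_iff_left _ ?_).1 hk
      split_ifs
      exacts [hbK, zero_mem _]
    rw [hsplit, coeff_add, coeff_C_mul_X_pow]
    refine add_mem hg ?_
    split_ifs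
    exacts [hlead, zero_mem _]

/-- Finitely many elements have a common denominator `d` such that one of the resulting
numerators, or `d` itself, avoids a given prime. -/
theorem IsFractionInvertible.exists_denom {φ : A →+* B} (h : IsFractionInvertible φ)
    (m : Ideal A) [m.IsPrime] (F : Finset B) :
    ∃ d : A, (∀ y ∈ F, d ∈ denomIdeal φ y) ∧
      (d ∉ m ∨ ∃ y ∈ F, ∃ r ∉ m, φ r = φ d * y) := by
  classical
  induction F using Finset.induction_on with
  | empty =>
    exact ⟨1, by simp, Or.inl fun h1 => Ideal.IsPrime.ne_top ‹_› ((Ideal.eq_top_iff_one _).2 h1)⟩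
  | insert t F ht ih =>
    obtain ⟨d, hd, hdm⟩ := ih
    -- Now `1 = a + b d t` with `a d t` in the image of `A`. If `a ∈ m`, the denominator `b d` gives
    -- `t` the numerator `1 - a ∉ m`; otherwise `a d` works and preserves what already avoided `m`.
    obtain ⟨a, ⟨c, hc⟩, b, hb⟩ := h (φ d * t)
    have hb' : φ (1 - a) = φ (b * d) * t := by
      rw [map_sub, hb, map_mul]
      ring
    by_cases ham : a ∈ m
    · refine ⟨b * d, ?_, Or.inr ⟨t, Finset.mem_insert_self _ _, 1 - a, fun h1 => ?_, hb'⟩⟩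
      · intro y hy
        rcases Finset.mem_insert.1 hy with rfl | hy
        · exact ⟨_, hb'⟩
        · exact Ideal.mul_mem_left _ _ (hd y hy)
      · refine Ideal.IsPrime.ne_top ‹m.IsPrime› ((Ideal.eq_top_iff_one _).2 ?_)
        simpa using add_mem h1 ham
    · refine ⟨a * d, ?_, ?_⟩
      · intro y hy
        rcases Finset.mem_insert.1 hy with rfl | hy
        · exact ⟨c, by rw [hc, map_mul, mul_assoc]⟩
        · exact Ideal.mul_mem_left _ _ (hd y hy)
      · rcases hdm with hdm | ⟨y, hy, r, hr, hry⟩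
        · exact Or.inl fun h' => (Ideal.IsPrime.mem_or_mem ‹_› h').elim ham hdm
        · refine Or.inr ⟨y, Finset.mem_insert_of_mem hy, a * r,
            fun h' => (Ideal.IsPrime.mem_or_mem ‹_› h').elim ham hr, ?_⟩
          rw [map_mul, hry, map_mul, mul_assoc]

/-! ### Polynomials of unit content along ring maps -/

/-- Every polynomial of unit content over `B` divides the image of one over `A`. -/
def UnitContentDominates (φ : A →+* B) : Prop :=
  ∀ g : B[X], g.contentIdeal = ⊤ → ∃ p : A[X], p.contentIdeal = ⊤ ∧ g ∣ p.map φ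

theorem UnitContentDominates.comp {C : Type*} [CommRing C] {φ : A →+* B} {ψ : B →+* C}
    (hφ : UnitContentDominates φ) (hψ : UnitContentDominates ψ) :
    UnitContentDominates (ψ.comp φ) := by
  intro g hg
  obtain ⟨p, hp, hgp⟩ := hψ g hg
  obtain ⟨q, hq, hpq⟩ := hφ p hp
  refine ⟨q, hq, hgp.trans ?_⟩
  rw [← Polynomial.map_map]
  exact Polynomial.map_dvd ψ hpq

theorem IsFractionInvertible.unitContentDominates {φ : A →+* B}
    (hφ : Function.Injective φ) (h : IsFractionInvertible φ) : UnitContentDominates φ := by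
  classical
  intro g hg
  obtain ⟨u, hu, hu'⟩ := exists_mem_contentIdeal_eq_top
    ((Ideal.span {g}).comap (mapRingHom φ)) (fun m hm => by
      have := hm.isPrime
      have h1 : (1 : B) ∈ g.contentIdeal := hg ▸ Submodule.mem_top
      rw [contentIdeal_def] at h1
      obtain ⟨c, -, hc⟩ := Submodule.mem_span_finset.1 h1
      -- With `1 = ∑ c y * y` over the coefficients `y` of `g`, clear all products `c y * z`. One
      -- numerator avoids `m`: if `d ∉ m`, use `d = ∑ d * (c y * y)`. The corresponding multiple `d
      -- * c y * g` then lifts to `A[X]` with a coefficient outside `m`.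
      obtain ⟨d, hd, hdm⟩ := h.exists_denom m
        ((g.coeffs ×ˢ g.coeffs).image fun yz => c yz.1 * yz.2)
      have key : ∃ y ∈ g.coeffs, ∃ z ∈ g.coeffs, ∃ r ∉ m, φ r = φ d * (c y * z) := by
        rcases hdm with hdm | ⟨y, hy, r, hr, hry⟩
        · by_contra! hcon
          have : ∀ y ∈ g.coeffs, ∃ r ∈ m, φ r = φ d * (c y * y) := by
            intro y hy
            obtain ⟨r, hr⟩ := hd (c y * y)
              (Finset.mem_image.2 ⟨(y, y), Finset.mem_product.2 ⟨hy, hy⟩, rfl⟩)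
            exact ⟨r, by_contra fun hrm => hcon y hy y hy r hrm hr, hr⟩
          choose! r hr hr' using this
          refine hdm ?_
          have : d = ∑ y ∈ g.coeffs, r y := hφ (by
            rw [map_sum, Finset.sum_congr rfl hr', ← Finset.mul_sum]
            simp only [smul_eq_mul] at hc
            rw [hc, mul_one])
          rw [this]
          exact sum_mem hr
        · obtain ⟨⟨y, z⟩, hyz, rfl⟩ := Finset.mem_image.1 hy
          obtain ⟨hy, hz⟩ := Finset.mem_product.1 hyz
          exact ⟨y, hy, z, hz, r, hr, hry⟩
      obtain ⟨y, hy, z, hz, r, hr, hrz⟩ := key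
      have hlift : C (φ d * c y) * g ∈ lifts φ := by
        rw [lifts_iff_coeff_lifts]
        intro n
        rw [coeff_C_mul]
        by_cases hn : g.coeff n = 0
        · exact ⟨0, by simp [hn]⟩
        · obtain ⟨s, hs⟩ := hd (c y * g.coeff n) (Finset.mem_image.2
            ⟨(y, g.coeff n), Finset.mem_product.2 ⟨hy, coeff_mem_coeffs hn⟩, rfl⟩)
          exact ⟨s, by rw [hs, mul_assoc]⟩
      obtain ⟨q, hq⟩ := (mem_lifts _).1 hlift
      obtain ⟨n, -, rfl⟩ := mem_coeffs_iff.1 hz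
      refine ⟨q, ?_, n, ?_⟩
      · rw [Ideal.mem_comap, coe_mapRingHom, hq, Ideal.mem_span_singleton]
        exact Dvd.intro_left _ rfl
      · have : q.coeff n = r := hφ (by
          rw [← coeff_map, hq, coeff_C_mul, hrz, mul_assoc])
        rwa [this])
  exact ⟨u, hu', Ideal.mem_span_singleton.1 hu⟩

end RingHom

-- If `(g) ∩ A[X] ⊆ m[X]`, lying over gives a prime `Q ∋ g` of `B[X]` above `m[X]`. With `n = Q ∩
-- B`, both `n[X] ⊆ Q` lie over `m[X]`, so incomparability gives `Q = n[X]`, and the content of `g`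
-- is inside `n`.
attribute [local instance] Polynomial.algebra in
theorem unitContentDominates_of_isIntegral (A B : Type*) [CommRing A] [CommRing B] [Algebra A B]
    [Algebra.IsIntegral A B] : UnitContentDominates (algebraMap A B) := by
  intro g hg
  obtain ⟨u, hu, hu'⟩ := exists_mem_contentIdeal_eq_top
    ((Ideal.span {g}).comap (algebraMap A[X] B[X])) (fun m hm => by
      have := hm.isPrime
      have hprime : (m.map (C : A →+* A[X])).IsPrime := Ideal.isPrime_map_C_of_isPrime
      by_contra! hcon
      obtain ⟨Q, hgQ, hQ, hQm⟩ := Ideal.exists_ideal_over_prime_of_isIntegral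
        (m.map (C : A →+* A[X])) (Ideal.span {g})
        (fun u hu => Ideal.mem_map_C_iff.2 (hcon u hu))
      have hQn : (Q.comap (C : B →+* B[X])).IsPrime := Ideal.comap_isPrime _ _
      have hmQ : (Q.comap (C : B →+* B[X])).comap (algebraMap A B) = m := by
        ext a
        have := SetLike.ext_iff.1 hQm (C a)
        simpa [Ideal.mem_map_C_iff, coeff_C, apply_ite] using this
      have hle : (Q.comap (C : B →+* B[X])).map (C : B →+* B[X]) ≤ Q := Ideal.map_comap_le
      have hpr : ((Q.comap (C : B →+* B[X])).map (C : B →+* B[X])).IsPrime :=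
        Ideal.isPrime_map_C_of_isPrime
      have heq : (Q.comap (C : B →+* B[X])).map (C : B →+* B[X]) = Q := by
        by_contra hne
        have hlt := Ideal.IsIntegral.comap_lt_comap (R := A[X]) (lt_of_le_of_ne hle hne)
        rw [hQm] at hlt
        refine hlt.not_ge (Ideal.map_le_iff_le_comap.2 fun a ha => ?_)
        rw [Ideal.mem_comap, Ideal.mem_comap]
        have : a ∈ (Q.comap (C : B →+* B[X])).comap (algebraMap A B) := hmQ ▸ ha
        simpa using Ideal.mem_map_of_mem (C : B →+* B[X]) (Ideal.mem_comap.1 this)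
      have hgm : g ∈ (Q.comap (C : B →+* B[X])).map (C : B →+* B[X]) := by
        rw [heq]
        exact hgQ (Ideal.mem_span_singleton_self g)
      have := contentIdeal_le_iff.2 (Ideal.mem_map_C_iff.1 hgm)
      rw [hg, top_le_iff] at this
      exact hQn.ne_top this)
  exact ⟨u, hu', Ideal.mem_span_singleton.1 hu⟩


/-! ### An elementwise characterization of Prüfer extensions -/

section

variable {R T : Type*} [CommRing R] [CommRing T] [Algebra R T]

theorem IsFractionInvertible.isEpi (h : IsFractionInvertible (algebraMap R T)) :
    Algebra.IsEpi R T := by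
  rw [Algebra.isEpi_iff_forall_one_tmul_eq]
  intro x
  obtain ⟨a, ⟨c, hc⟩, b, hb⟩ := h x
  have hbx : b • x = algebraMap R T (1 - a) := by
    rw [Algebra.smul_def, map_sub, hb]
    ring
  have h1 : (1 : T) = a • 1 + b • x := by
    rw [Algebra.smul_def, Algebra.smul_def, mul_one, ← hb, map_one]
  have hc' : a • x = c • (1 : T) := by
    rw [Algebra.smul_def, Algebra.smul_def, mul_one, hc]
  have hbx' : b • x = (1 - a) • (1 : T) := by rw [hbx, Algebra.smul_def, mul_one]
  calc (1 : T) ⊗ₜ[R] x = (a • 1 + b • x) ⊗ₜ[R] x := by rw [← h1]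
    _ = (1 : T) ⊗ₜ[R] (a • x) + x ⊗ₜ[R] (b • x) := by
      rw [TensorProduct.add_tmul, TensorProduct.smul_tmul, TensorProduct.smul_tmul]
    _ = (a • x) ⊗ₜ[R] (1 : T) + (1 - a) • (x ⊗ₜ[R] (1 : T)) := by
      rw [hc', hbx', ← TensorProduct.smul_tmul, TensorProduct.tmul_smul]
    _ = x ⊗ₜ[R] 1 := by
      rw [← TensorProduct.smul_tmul', sub_smul, one_smul]
      abel

theorem IsFractionInvertible.map_denomIdeal (h : IsFractionInvertible (algebraMap R T)) (x : T) :
    (denomIdeal (algebraMap R T) x).map (algebraMap R T) = ⊤ := by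
  obtain ⟨a, ha, b, hb⟩ := h x
  rw [Ideal.eq_top_iff_one, ← map_one (algebraMap R T), hb]
  refine add_mem (Ideal.mem_map_of_mem _ ha) (Ideal.mul_mem_right _ _ (Ideal.mem_map_of_mem _ ?_))
  -- The coefficient `b` is itself a denominator of `x`, since `b x = 1 - a`.
  exact ⟨1 - a, by rw [map_sub, hb]; ring⟩

/-- For `z` in `T ⊗ I` there is an ideal `J` with `J T = T` and `J z ⊆ 1 ⊗ I`. If `z` dies in `T`,
injectivity of `R → T` gives `J z = 0`; the annihilator of `z` in `T` then contains `J T = T`. -/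
theorem IsFractionInvertible.flat (hinj : Function.Injective (algebraMap R T))
    (h : IsFractionInvertible (algebraMap R T)) : Module.Flat R T := by
  rw [Module.Flat.iff_lTensor_injective']
  intro I
  rw [injective_iff_map_eq_zero]
  have key : ∀ z : T ⊗[R] I, ∃ J : Ideal R, J.map (algebraMap R T) = ⊤ ∧
      ∀ r ∈ J, ∃ i : I, r • z = (1 : T) ⊗ₜ[R] i := by
    intro z
    induction z using TensorProduct.induction_on with
    | zero => exact ⟨⊤, Ideal.map_top _, fun r _ => ⟨0, by simp⟩⟩
    | tmul t i =>
      refine ⟨_, h.map_denomIdeal t, fun r ⟨c, hc⟩ => ⟨c • i, ?_⟩⟩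
      rw [TensorProduct.smul_tmul', Algebra.smul_def, ← hc, Algebra.algebraMap_eq_smul_one,
        TensorProduct.smul_tmul]
    | add z w hz hw =>
      obtain ⟨J, hJ, hJz⟩ := hz
      obtain ⟨K, hK, hKw⟩ := hw
      refine ⟨J ⊓ K, ?_, fun r ⟨hrJ, hrK⟩ => ?_⟩
      · refine top_le_iff.1 ((le_of_eq ?_).trans (Ideal.map_mono Ideal.mul_le_inf))
        rw [Ideal.map_mul, hJ, hK, Ideal.mul_top]
      · obtain ⟨i, hi⟩ := hJz r hrJ
        obtain ⟨j, hj⟩ := hKw r hrK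
        exact ⟨i + j, by rw [smul_add, hi, hj, TensorProduct.tmul_add]⟩
  intro z hz
  obtain ⟨J, hJ, hJz⟩ := key z
  have hle : J.map (algebraMap R T) ≤ LinearMap.ker (LinearMap.toSpanSingleton T (T ⊗[R] I) z) := by
    rw [Ideal.map_le_iff_le_comap]
    intro r hr
    rw [Ideal.mem_comap, LinearMap.mem_ker, LinearMap.toSpanSingleton_apply, algebraMap_smul]
    obtain ⟨i, hi⟩ := hJz r hr
    have h0 := congrArg (TensorProduct.rid R T) (congrArg (LinearMap.lTensor T I.subtype) hi)
    rw [map_smul, hz, smul_zero, map_zero, LinearMap.lTensor_tmul, TensorProduct.rid_tmul,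
      Submodule.subtype_apply, ← Algebra.algebraMap_eq_smul_one, eq_comm,
      map_eq_zero_iff _ hinj] at h0
    have hi0 : i = 0 := Subtype.ext h0
    rw [hi, hi0, TensorProduct.tmul_zero]
  have h1 : (1 : T) ∈ J.map (algebraMap R T) := hJ ▸ Submodule.mem_top
  simpa using hle h1

/-- The ideal `(R : x)` is the kernel of `r ↦ r x` into `T / R`. After the exact functor `T ⊗ -`,
the element `1 ⊗ 1` goes to the class of `1 ⊗ x = x ⊗ 1`, which is zero, so it comes from `T ⊗ (R :
x)`. -/
theorem map_denomIdeal_eq_top_of_flat_of_isEpi [Module.Flat R T] [Algebra.IsEpi R T] (x : T) :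
    (denomIdeal (algebraMap R T) x).map (algebraMap R T) = ⊤ := by
  set N := LinearMap.range (Algebra.linearMap R T)
  set D := denomIdeal (algebraMap R T) x
  let f : R →ₗ[R] T ⧸ N := LinearMap.toSpanSingleton R _ (N.mkQ x)
  have hex : Function.Exact D.subtype f := by
    intro r
    rw [Submodule.coe_subtype, Subtype.range_coe, LinearMap.toSpanSingleton_apply, ← map_smul,
      Submodule.mkQ_apply, Submodule.Quotient.mk_eq_zero, Algebra.smul_def]
    rfl
  have hex' := Module.Flat.lTensor_exact T hex
  have hzero : f.lTensor T ((1 : T) ⊗ₜ[R] (1 : R)) = 0 := by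
    rw [LinearMap.lTensor_tmul, LinearMap.toSpanSingleton_apply, one_smul,
      ← LinearMap.lTensor_tmul, (Algebra.isEpi_iff_forall_one_tmul_eq R T).1 inferInstance x,
      LinearMap.lTensor_tmul]
    have : N.mkQ 1 = 0 := (Submodule.Quotient.mk_eq_zero N).2 ⟨1, map_one (algebraMap R T)⟩
    rw [this, TensorProduct.tmul_zero]
  obtain ⟨z, hz⟩ := (hex' _).1 hzero
  have key : ∀ z : T ⊗[R] D,
      TensorProduct.rid R T (D.subtype.lTensor T z) ∈ D.map (algebraMap R T) := by
    intro z
    induction z using TensorProduct.induction_on with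
    | zero => simp
    | tmul t d =>
      rw [LinearMap.lTensor_tmul, TensorProduct.rid_tmul, Algebra.smul_def]
      exact Ideal.mul_mem_right _ _ (Ideal.mem_map_of_mem _ d.2)
    | add z w hz hw =>
      rw [map_add, map_add]
      exact add_mem hz hw
  have := key z
  rw [hz, TensorProduct.rid_tmul, one_smul] at this
  exact (Ideal.eq_top_iff_one _).2 this

end

section

variable {R S : Type*} [CommRing R] [CommRing S] [Algebra R S]

theorem isPruferExtension_of_isFractionInvertible (hinj : Function.Injective (algebraMap R S))
    (h : IsFractionInvertible (algebraMap R S)) : IsPruferExtension R S := by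
  have hT (T : Subalgebra R S) : IsFractionInvertible (algebraMap R T) :=
    IsFractionInvertible.of_comp_injective (ψ := T.val.toRingHom) Subtype.val_injective h
  exact ⟨hinj, fun T => (hT T).flat (Function.Injective.of_comp (f := T.val) hinj),
    fun T => (hT T).isEpi⟩

/-- A finite epimorphism is surjective; apply this to `R → R[y]`. -/
theorem IsPruferExtension.mem_range_of_isIntegral (h : IsPruferExtension R S) {y : S}
    (hy : IsIntegral R y) : y ∈ (algebraMap R S).range := by
  let T := Algebra.adjoin R {y}
  have : Module.Finite R T := Module.Finite.iff_fg.2 hy.fg_adjoin_singleton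
  have := h.epi T
  obtain ⟨r, hr⟩ := Algebra.isEpi_iff_surjective_algebraMap_of_finite.1 this
    ⟨y, Algebra.self_mem_adjoin_singleton R y⟩
  exact ⟨r, congrArg Subtype.val hr⟩

/-- In `R[x]` the ideal `(R : x)` generates `1`, so `p(x) = 1` for some `p` with coefficients in `(R
: x)`. The relation `1 - p` puts `1 - p.coeff 0` in `(R : x) + x (R : x)`, and `p.coeff 0` is there
already. -/
theorem IsPruferExtension.isFractionInvertible (h : IsPruferExtension R S) :
    IsFractionInvertible (algebraMap R S) := by
  intro x
  let T := Algebra.adjoin R {x}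
  have := h.flat T
  have := h.epi T
  let x' : T := ⟨x, Algebra.self_mem_adjoin_singleton R x⟩
  have htop := map_denomIdeal_eq_top_of_flat_of_isEpi (R := R) x'
  have hsurj : Function.Surjective (aeval (R := R) x') := by
    rintro ⟨y, hy⟩
    obtain ⟨p, hp⟩ := (Algebra.adjoin_singleton_eq_range_aeval R x).le hy
    refine ⟨p, Subtype.ext ?_⟩
    exact (aeval_algHom_apply T.val x' p).symm.trans hp
  have hcomp : (algebraMap R T) = ((aeval (R := R) x' : R[X] →ₐ[R] T) : R[X] →+* T).comp C := by
    ext r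
    simp
  rw [hcomp, ← Ideal.map_map] at htop
  obtain ⟨p, hp, hp1⟩ := (Ideal.mem_map_iff_of_surjective _ hsurj).1
    ((Ideal.eq_top_iff_one _).1 htop)
  have hpx : aeval x p = 1 := by
    exact (aeval_algHom_apply T.val x' p).trans (congrArg T.val hp1)
  have hD : p.coeff 0 ∈ fractionProductIdeal (algebraMap R S) x := by
    obtain ⟨c, hc⟩ := Ideal.mem_map_C_iff.1 hp 0
    refine denomIdeal_le_fractionProductIdeal _ _ ⟨c, ?_⟩
    have := congrArg Subtype.val hc
    simpa [x'] using this
  have := coeff_mem_fractionProductIdeal (φ := algebraMap R S)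
    (fun y hy => h.mem_range_of_isIntegral hy) x (1 - p)
    (by rw [← aeval_def, map_sub, map_one, hpx, sub_self]) 0
  rw [coeff_sub, coeff_one_zero] at this
  simpa using add_mem this hD

theorem isPruferExtension_iff : IsPruferExtension R S ↔
    Function.Injective (algebraMap R S) ∧ IsFractionInvertible (algebraMap R S) :=
  ⟨fun h => ⟨h.injective, h.isFractionInvertible⟩,
    fun h => isPruferExtension_of_isFractionInvertible h.1 h.2⟩

/-! ### Quasi-Prüfer extensions and roots of polynomials of unit content -/

theorem IsPruferExtension.isQuasiPruferExtension (h : IsPruferExtension R S) :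
    IsQuasiPruferExtension R S := by
  refine ⟨h.injective, integralClosure R S, inferInstance, ?_⟩
  exact isPruferExtension_iff.2 ⟨Subtype.val_injective,
    IsFractionInvertible.of_comp (φ := algebraMap R (integralClosure R S)) h.isFractionInvertible⟩

/-- The elementwise condition survives enlarging the base, so any integral intermediate ring may be
replaced by the integral closure. -/
theorem isQuasiPruferExtension_iff : IsQuasiPruferExtension R S ↔
    Function.Injective (algebraMap R S) ∧ IsPruferExtension (integralClosure R S) S := by
  refine ⟨fun h => ⟨h.injective, ?_⟩, fun h => ⟨h.1, _, inferInstance, h.2⟩⟩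
  obtain ⟨R', hint, hP⟩ := h.exists_factorization
  have hle : R' ≤ integralClosure R S := le_integralClosure_iff_isIntegral.2 hint
  refine isPruferExtension_iff.2 ⟨Subtype.val_injective, ?_⟩
  exact IsFractionInvertible.of_comp (φ := (Subalgebra.inclusion hle).toRingHom)
    hP.isFractionInvertible

/-- In a quasi-Prüfer extension, every element is a root of a polynomial of unit content. -/
theorem IsQuasiPruferExtension.exists_root (h : IsQuasiPruferExtension R S) (x : S) :
    ∃ p : R[X], p.contentIdeal = ⊤ ∧ aeval x p = 0 := by
  obtain ⟨a, ⟨c, hc⟩, b, hb⟩ := (isQuasiPruferExtension_iff.1 h).2.isFractionInvertible x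
  -- Combines the relations `b x = 1 - a` and `a x = c`; the shift by `X ^ 2` prevents overlap, so
  -- `-(1 - a)` and `a` are coefficients and generate `1`.
  let f : (integralClosure R S)[X] := (C b * X - C (1 - a)) + X ^ 2 * (C a * X - C c)
  have hf : f.contentIdeal = ⊤ := by
    have h0 : f.coeff 0 = -(1 - a) := by simp [f]
    have h3 : f.coeff 3 = a := by
      simp [f, coeff_X_pow_mul', coeff_one, coeff_C]
    have m0 := f.coeff_mem_contentIdeal 0
    have m3 := f.coeff_mem_contentIdeal 3
    rw [h0] at m0
    rw [h3] at m3
    rw [Ideal.eq_top_iff_one]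
    simpa using sub_mem m3 m0
  have hroot : aeval x f = 0 := by
    simp only [f, map_add, map_sub, map_mul, map_pow, aeval_C, aeval_X, hb, hc]
    ring
  obtain ⟨p, hp, q, hpq⟩ := unitContentDominates_of_isIntegral R (integralClosure R S) f hf
  refine ⟨p, hp, ?_⟩
  rw [← aeval_map_algebraMap (integralClosure R S), hpq, map_mul, hroot, zero_mul]

theorem isQuasiPruferExtension_of_exists_root (hinj : Function.Injective (algebraMap R S))
    (h : ∀ x : S, ∃ p : R[X], p.contentIdeal = ⊤ ∧ aeval x p = 0) :
    IsQuasiPruferExtension R S := by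
  refine isQuasiPruferExtension_iff.2 ⟨hinj, isPruferExtension_iff.2
    ⟨Subtype.val_injective, fun x => ?_⟩⟩
  obtain ⟨p, hp, hpx⟩ := h x
  have hle := contentIdeal_le_iff.2 (coeff_mem_fractionProductIdeal
    (φ := algebraMap (integralClosure R S) S)
    (fun y hy => ⟨⟨y, isIntegral_trans y hy⟩, rfl⟩) x (p.map (algebraMap R _))
    (by rw [← aeval_def, aeval_map_algebraMap, hpx]))
  rw [contentIdeal_map_eq_map_contentIdeal, hp, Ideal.map_top] at hle
  exact hle Submodule.mem_top

end


/-! ### Nagata rings -/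

namespace NagataRing

theorem algebraMap_injective (R : Type*) [CommRing R] :
    Function.Injective (algebraMap R[X] (NagataRing R)) :=
  IsLocalization.injective (M := unitContent R) _ fun _ hp =>
    mem_nonZeroDivisors_of_contentIdeal_eq_top hp

theorem isUnit_algebraMap {R : Type*} [CommRing R] {p : R[X]} (hp : p.contentIdeal = ⊤) :
    IsUnit (algebraMap R[X] (NagataRing R) p) :=
  IsLocalization.map_units (NagataRing R) (⟨p, hp⟩ : unitContent R)

theorem exists_mul_eq {R : Type*} [CommRing R] (z : NagataRing R) :
    ∃ p : R[X], p.contentIdeal = ⊤ ∧ ∃ f : R[X],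
      algebraMap R[X] (NagataRing R) p * z = algebraMap R[X] (NagataRing R) f := by
  obtain ⟨⟨f, p⟩, h⟩ := IsLocalization.surj (unitContent R) z
  exact ⟨p, p.2, f, by rw [mul_comm]; exact h⟩

variable {R S : Type*} [CommRing R] [CommRing S] [Algebra R S]

theorem map_injective (hinj : Function.Injective (algebraMap R S)) :
    Function.Injective (map R S) := by
  rw [injective_iff_map_eq_zero]
  intro z hz
  obtain ⟨p, hp, f, hf⟩ := exists_mul_eq z
  have h := congrArg (map R S) hf
  rw [map_mul, hz, mul_zero, map_algebraMap, eq_comm,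
    map_eq_zero_iff _ (algebraMap_injective S), Polynomial.map_eq_zero_iff hinj] at h
  rw [h, map_zero] at hf
  exact ((isUnit_algebraMap hp).mul_right_eq_zero).1 hf

theorem map_comp_map {T : Type*} [CommRing T] [Algebra R T] [Algebra T S] [IsScalarTower R T S] :
    (map T S).comp (map R T) = map R S := by
  refine IsLocalization.ringHom_ext (unitContent R) (RingHom.ext fun p => ?_)
  simp only [RingHom.comp_apply, map_algebraMap, Polynomial.map_map,
    ← IsScalarTower.algebraMap_eq]

theorem exists_map_mul_eq (h : UnitContentDominates (algebraMap R S)) (z : NagataRing S) :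
    ∃ p : R[X], p.contentIdeal = ⊤ ∧ ∃ f : S[X],
      map R S (algebraMap R[X] (NagataRing R) p) * z = algebraMap S[X] (NagataRing S) f := by
  obtain ⟨g, hg, f, hf⟩ := exists_mul_eq z
  obtain ⟨p, hp, q, hq⟩ := h g hg
  exact ⟨p, hp, q * f, by rw [map_algebraMap, hq, mul_comm g, map_mul, mul_assoc, hf, ← map_mul]⟩

/-! #### Base change -/

/-- The canonical map `S[X] → S ⊗[R] R(X)`. -/
def polynomialToTensor (R S : Type*) [CommRing R] [CommRing S] [Algebra R S] :
    S[X] →ₐ[S] S ⊗[R] NagataRing R :=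
  aeval (1 ⊗ₜ algebraMap R[X] (NagataRing R) X)

theorem polynomialToTensor_map (p : R[X]) :
    polynomialToTensor R S (p.map (algebraMap R S)) =
      1 ⊗ₜ algebraMap R[X] (NagataRing R) p := by
  have : ((polynomialToTensor R S).restrictScalars R).comp
      (Polynomial.mapAlgHom (Algebra.ofId R S)) =
      (Algebra.TensorProduct.includeRight (R := R) (A := S)).comp
        (IsScalarTower.toAlgHom R R[X] (NagataRing R)) := by
    refine Polynomial.algHom_ext ?_
    simp [polynomialToTensor]
  exact DFunLike.congr_fun this p

theorem tensorMap_polynomialToTensor (f : S[X]) :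
    tensorMap R S (polynomialToTensor R S f) = algebraMap S[X] (NagataRing S) f := by
  have : (tensorMap R S).comp (polynomialToTensor R S) =
      IsScalarTower.toAlgHom S S[X] (NagataRing S) := by
    refine Polynomial.algHom_ext ?_
    simp [polynomialToTensor, tensorMap_tmul, map_algebraMap]
  exact DFunLike.congr_fun this f

theorem exists_tmul_mul_eq (z : S ⊗[R] NagataRing R) :
    ∃ p : R[X], p.contentIdeal = ⊤ ∧ ∃ f : S[X],
      (1 ⊗ₜ algebraMap R[X] (NagataRing R) p) * z = polynomialToTensor R S f := by
  induction z using TensorProduct.induction_on with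
  | zero => exact ⟨1, contentIdeal_one, 0, by simp⟩
  | tmul s w =>
    obtain ⟨p, hp, f, hf⟩ := exists_mul_eq w
    refine ⟨p, hp, C s * f.map (algebraMap R S), ?_⟩
    rw [Algebra.TensorProduct.tmul_mul_tmul, hf, map_mul, polynomialToTensor_map, ← algebraMap_eq,
      AlgHom.commutes, Algebra.TensorProduct.algebraMap_apply,
      Algebra.TensorProduct.tmul_mul_tmul]
    simp
  | add z w hz hw =>
    obtain ⟨p, hp, f, hf⟩ := hz
    obtain ⟨q, hq, g, hg⟩ := hw
    refine ⟨p * q, contentIdeal_mul_eq_top_of_contentIdeal_eq_top hp hq,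
      q.map (algebraMap R S) * f + p.map (algebraMap R S) * g, ?_⟩
    have hpq : (1 : S) ⊗ₜ[R] algebraMap R[X] (NagataRing R) (p * q) =
        1 ⊗ₜ algebraMap R[X] (NagataRing R) p * 1 ⊗ₜ algebraMap R[X] (NagataRing R) q := by simp
    rw [map_add, map_mul (polynomialToTensor R S), map_mul (polynomialToTensor R S),
      polynomialToTensor_map, polynomialToTensor_map, ← hf, ← hg, hpq]
    ring

/-- Up to units from `R[X]`, every element of the tensor product comes from `S[X]`, which embeds in
`S(X)`; this gives injectivity. Surjectivity is where denominators over `R` are needed. -/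
theorem tensorMap_bijective (h : UnitContentDominates (algebraMap R S)) :
    Function.Bijective (tensorMap R S) := by
  have hunit {p : R[X]} (hp : p.contentIdeal = ⊤) :
      IsUnit ((1 : S) ⊗ₜ[R] algebraMap R[X] (NagataRing R) p) :=
    (isUnit_algebraMap hp).map (Algebra.TensorProduct.includeRight (R := R) (A := S))
  constructor
  · rw [injective_iff_map_eq_zero]
    intro z hz
    obtain ⟨p, hp, f, hf⟩ := exists_tmul_mul_eq z
    have h0 := congrArg (tensorMap R S) hf
    rw [map_mul, hz, mul_zero, tensorMap_polynomialToTensor, eq_comm,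
      map_eq_zero_iff _ (algebraMap_injective S)] at h0
    rw [h0, map_zero] at hf
    exact ((hunit hp).mul_right_eq_zero).1 hf
  · intro z
    obtain ⟨p, hp, f, hf⟩ := exists_map_mul_eq h z
    obtain ⟨v, hv⟩ := (hunit hp).exists_right_inv
    refine ⟨v * polynomialToTensor R S f, ?_⟩
    have hv' := congrArg (tensorMap R S) hv
    rw [map_mul, tensorMap_tmul, map_one, map_one, one_mul] at hv'
    rw [map_mul, tensorMap_polynomialToTensor, ← hf, ← mul_assoc, mul_comm _ (map R S _), hv',
      one_mul]

/-! #### Integrality -/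

attribute [local instance] Polynomial.algebra in
theorem isIntegral_map [Algebra.IsIntegral R S] : (map R S).IsIntegral := by
  intro z
  obtain ⟨p, hp, f, hf⟩ := exists_map_mul_eq (unitContentDominates_of_isIntegral R S) z
  obtain ⟨F, hF, hFf⟩ : IsIntegral R[X] f := Algebra.IsIntegral.isIntegral f
  obtain ⟨v, hv⟩ := (isUnit_algebraMap hp).exists_right_inv
  have hint : (map R S).IsIntegralElem (algebraMap S[X] (NagataRing S) f) := by
    refine ⟨F.map (algebraMap R[X] (NagataRing R)), hF.map _, ?_⟩
    have hcomp : (map R S).comp (algebraMap R[X] (NagataRing R)) =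
        (algebraMap S[X] (NagataRing S)).comp (algebraMap R[X] S[X]) :=
      RingHom.ext fun q => map_algebraMap R S q
    rw [eval₂_map, hcomp, ← hom_eval₂, hFf, map_zero]
  have hz : z = map R S v * algebraMap S[X] (NagataRing S) f := by
    rw [← hf, ← mul_assoc, ← map_mul, mul_comm v, hv, map_one, one_mul]
  rw [hz]
  exact ((map R S).isIntegralElem_map).mul _ hint

/-! #### Prüfer extensions -/

theorem isFractionInvertible_map (hinj : Function.Injective (algebraMap R S))
    (h : IsFractionInvertible (algebraMap R S)) : IsFractionInvertible (map R S) := by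
  intro z
  obtain ⟨p, hp, f, hf⟩ := exists_map_mul_eq (h.unitContentDominates hinj) z
  obtain ⟨v, hv⟩ := (isUnit_algebraMap hp).exists_right_inv
  -- Solve the problem for the numerator `f` over `R[X]`, with `u` of unit content in place of `1`;
  -- `u` becomes a unit in `R(X)`.
  obtain ⟨u, ⟨a, ⟨c, hc⟩, b, hb⟩, hu⟩ := exists_mem_contentIdeal_eq_top
    (fractionProductIdeal (mapRingHom (algebraMap R S)) f) (fun m hm => by
      have := hm.isPrime
      obtain ⟨d, hd, hdm⟩ := h.exists_denom m f.coeffs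
      have hlift : C (algebraMap R S d) * f ∈ lifts (algebraMap R S) := by
        rw [lifts_iff_coeff_lifts]
        intro n
        rw [coeff_C_mul]
        by_cases hn : f.coeff n = 0
        · exact ⟨0, by simp [hn]⟩
        · exact hd _ (coeff_mem_coeffs hn)
      obtain ⟨q, hq⟩ := (mem_lifts _).1 hlift
      rcases hdm with hdm | ⟨y, hy, r, hr, hry⟩
      · refine ⟨C d, denomIdeal_le_fractionProductIdeal _ _ ⟨q, by simpa using hq⟩, 0, ?_⟩
        rwa [coeff_C_zero]
      · obtain ⟨n, -, rfl⟩ := mem_coeffs_iff.1 hy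
        refine ⟨q, mem_fractionProductIdeal_of_eq_mul (b := C d) (by simpa using hq), n, ?_⟩
        have : q.coeff n = r := hinj (by rw [← coeff_map, hq, coeff_C_mul, hry])
        rwa [this])
  have hu' : algebraMap R[X] (NagataRing R) u ∈ fractionProductIdeal (map R S) z := by
    refine ⟨algebraMap _ _ a, ⟨v * algebraMap _ _ c, ?_⟩, algebraMap _ _ (b * p), ?_⟩
    · have hz : z = map R S v * algebraMap S[X] (NagataRing S) f := by
        rw [← hf, ← mul_assoc, ← map_mul, mul_comm v, hv, map_one, one_mul]
      rw [map_mul, map_algebraMap, map_algebraMap, ← coe_mapRingHom, hc, hz, map_mul,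
        coe_mapRingHom]
      ring
    · rw [map_mul (algebraMap R[X] (NagataRing R)), map_mul (map R S), mul_assoc, hf,
        map_algebraMap, map_algebraMap, map_algebraMap, ← map_mul, ← map_add]
      exact congrArg _ hb
  rw [Ideal.eq_top_of_isUnit_mem _ hu' (isUnit_algebraMap hu)]
  exact Submodule.mem_top

/-- Clear denominators in `1 = a + b x` and `a x = c` and compare coefficients: each coefficient of
`p * q * r` lies in `(R : x) + x (R : x)`, and these coefficients generate `1`. -/
theorem isFractionInvertible_of_map
    (h : IsFractionInvertible (map R S)) : IsFractionInvertible (algebraMap R S) := by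
  intro x
  obtain ⟨a, ⟨c, hc⟩, b, hb⟩ := h (algebraMap S[X] (NagataRing S) (C x))
  obtain ⟨p, hp, a', ha⟩ := exists_mul_eq a
  obtain ⟨q, hq, b', hb'⟩ := exists_mul_eq b
  obtain ⟨r, hr, c', hc'⟩ := exists_mul_eq c
  have hpqr := contentIdeal_mul_eq_top_of_contentIdeal_eq_top
    (contentIdeal_mul_eq_top_of_contentIdeal_eq_top hp hq) hr
  have e1 : (q * p * c').map (algebraMap R S) = (q * r * a').map (algebraMap R S) * C x := by
    apply algebraMap_injective S
    rw [map_mul, ← map_algebraMap, ← map_algebraMap, map_mul _ _ c', ← hc', map_mul _ _ a', ← ha]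
    simp only [map_mul, hc]
    ring
  have e2 : (p * q * r).map (algebraMap R S) =
      (q * r * a').map (algebraMap R S) + (p * r * b').map (algebraMap R S) * C x := by
    apply algebraMap_injective S
    rw [map_add, map_mul, ← map_algebraMap, ← map_algebraMap, ← map_algebraMap, map_mul _ _ b',
      ← hb', map_mul _ _ a', ← ha]
    rw [map_one] at hb
    simp only [map_mul]
    linear_combination (map R S (algebraMap _ _ p) * map R S (algebraMap _ _ q) *
      map R S (algebraMap _ _ r)) * hb
  have hle : (p * q * r).contentIdeal ≤ fractionProductIdeal (algebraMap R S) x := by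
    refine contentIdeal_le_iff.2 fun n => ?_
    have h1 := congrArg (coeff · n) e1
    have h2 := congrArg (coeff · n) e2
    simp only [coeff_add, coeff_mul_C, coeff_map] at h1 h2
    exact ⟨_, ⟨_, h1⟩, _, h2⟩
  exact hle (hpqr ▸ Submodule.mem_top)

/-- If `x` is a root of a polynomial of unit content over `R(X)`, then also of one over `R`. -/
theorem exists_root_of_exists_root_map (x : S) (F : (NagataRing R)[X])
    (hF : F.contentIdeal = ⊤)
    (hroot : F.eval₂ (map R S) (algebraMap S[X] (NagataRing S) (C x)) = 0) :
    ∃ p : R[X], p.contentIdeal = ⊤ ∧ aeval x p = 0 := by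
  obtain ⟨b, hbu, hb⟩ := IsLocalization.integerNormalization_spec (unitContent R) F
  set G := IsLocalization.integerNormalization (unitContent R) F
  have hbF : G.map (algebraMap R[X] (NagataRing R)) =
      C (algebraMap R[X] (NagataRing R) b) * F := by
    ext n
    rw [hb, coeff_smul, coeff_C_mul, Algebra.smul_def]
  have hG : (G.contentIdeal.map (algebraMap R[X] (NagataRing R))) = ⊤ := by
    rw [← contentIdeal_map_eq_map_contentIdeal, hbF]
    refine contentIdeal_mul_eq_top_of_contentIdeal_eq_top ?_ hF
    rw [contentIdeal_C, Ideal.span_singleton_eq_top]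
    exact isUnit_algebraMap hbu
  obtain ⟨p, hpG, hp⟩ : ∃ p ∈ G.contentIdeal, p ∈ unitContent R := by
    by_contra! hcon
    exact (IsLocalization.map_algebraMap_ne_top_iff_disjoint (unitContent R) (NagataRing R) _).2
      (Set.disjoint_left.2 fun p hp hpG => hcon p hpG hp) hG
  have hGroot : G.eval₂ (mapRingHom (algebraMap R S)) (C x) = 0 := by
    apply algebraMap_injective S
    have hcomp : (algebraMap S[X] (NagataRing S)).comp (mapRingHom (algebraMap R S)) =
        (map R S).comp (algebraMap R[X] (NagataRing R)) :=
      RingHom.ext fun q => (map_algebraMap R S q).symm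
    rw [hom_eval₂, hcomp, ← eval₂_map, hbF, eval₂_mul, hroot, mul_zero, map_zero]
  obtain ⟨u, hu, hu'⟩ := exists_mem_contentIdeal_eq_top (RingHom.ker (aeval (R := R) x))
    (fun m hm => by
      by_contra! hcon
      have hGm : G.contentIdeal ≤ m.map C := by
        refine contentIdeal_le_iff.2 fun j => Ideal.mem_map_C_iff.2 fun k => ?_
        -- `Fk` is the coefficient of `X ^ k` in `G`, read as a polynomial in the outer variable. As
        -- `x` is constant in `X`, it is a root of each `Fk`, so all coefficients of `Fk` lie in
        -- `m`.
        let Fk : R[X] := ∑ i ∈ Finset.range (G.natDegree + 1), monomial i ((G.coeff i).coeff k)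
        have hFk : Fk.coeff j = (G.coeff j).coeff k := by
          simp only [Fk, finsetSum_coeff, coeff_monomial, Finset.sum_ite_eq', Finset.mem_range]
          split_ifs with hj
          · rfl
          · rw [coeff_eq_zero_of_natDegree_lt (p := G) (by omega), coeff_zero]
        rw [← hFk]
        refine hcon Fk ?_ j
        rw [RingHom.mem_ker]
        have := congrArg (coeff · k) hGroot
        simp only [eval₂_eq_sum_range, finsetSum_coeff, coe_mapRingHom, ← C_pow, coeff_mul_C,
          coeff_map, coeff_zero] at this
        simpa [Fk, aeval_monomial] using this
      have := (contentIdeal_le_iff (I := m)).2 (Ideal.mem_map_C_iff.1 (hGm hpG))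
      rw [show p.contentIdeal = ⊤ from hp, top_le_iff] at this
      exact hm.ne_top this)
  exact ⟨u, hu', hu⟩

theorem isPruferExtension_iff_map (hinj : Function.Injective (algebraMap R S)) :
    letI : Algebra (NagataRing R) (NagataRing S) := algebra R S
    IsPruferExtension R S ↔ IsPruferExtension (NagataRing R) (NagataRing S) := by
  let : Algebra (NagataRing R) (NagataRing S) := algebra R S
  rw [isPruferExtension_iff, isPruferExtension_iff]
  exact ⟨fun h => ⟨map_injective hinj, isFractionInvertible_map hinj h.2⟩,
    fun h => ⟨hinj, isFractionInvertible_of_map h.2⟩⟩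

theorem isIntegral_map_integralClosure (z : NagataRing (integralClosure R S)) :
    letI : Algebra (NagataRing R) (NagataRing S) := algebra R S
    IsIntegral (NagataRing R) (map (integralClosure R S) S z) := by
  obtain ⟨F, hF, hFz⟩ := isIntegral_map (R := R) (S := integralClosure R S) z
  refine ⟨F, hF, ?_⟩
  change F.eval₂ (map R S) _ = 0
  rw [← map_comp_map (T := integralClosure R S), ← hom_eval₂, hFz, map_zero]

theorem isFractionInvertible_map_integralClosure (h : IsQuasiPruferExtension R S) :
    IsFractionInvertible (map (integralClosure R S) S) :=
  isFractionInvertible_map Subtype.val_injective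
    (isQuasiPruferExtension_iff.1 h).2.isFractionInvertible

theorem isQuasiPruferExtension_iff_map (hinj : Function.Injective (algebraMap R S)) :
    letI : Algebra (NagataRing R) (NagataRing S) := algebra R S
    IsQuasiPruferExtension R S ↔ IsQuasiPruferExtension (NagataRing R) (NagataRing S) := by
  let : Algebra (NagataRing R) (NagataRing S) := algebra R S
  refine ⟨fun h => ?_, fun h => ?_⟩
  · refine isQuasiPruferExtension_iff.2 ⟨map_injective hinj,
      isPruferExtension_iff.2 ⟨Subtype.val_injective, ?_⟩⟩
    exact IsFractionInvertible.of_comp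
      (φ := (map (integralClosure R S) S).codRestrict
        (integralClosure (NagataRing R) (NagataRing S)) isIntegral_map_integralClosure)
      (isFractionInvertible_map_integralClosure h)
  · refine isQuasiPruferExtension_of_exists_root hinj fun x => ?_
    obtain ⟨F, hF, hFx⟩ := h.exists_root (algebraMap S[X] (NagataRing S) (C x))
    exact exists_root_of_exists_root_map x F hF hFx

theorem integralClosure_toSubring (h : IsQuasiPruferExtension R S) :
    letI : Algebra (NagataRing R) (NagataRing S) := algebra R S
    (integralClosure (NagataRing R) (NagataRing S)).toSubring =
      (map (integralClosure R S) S).range := by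
  let : Algebra (NagataRing R) (NagataRing S) := algebra R S
  ext y
  constructor
  · rintro ⟨F, hF, hFy⟩
    let : Algebra (NagataRing (integralClosure R S)) (NagataRing S) :=
      algebra (integralClosure R S) S
    have hP : IsPruferExtension (NagataRing (integralClosure R S)) (NagataRing S) :=
      isPruferExtension_iff.2 ⟨map_injective Subtype.val_injective,
        isFractionInvertible_map_integralClosure h⟩
    -- An element integral over `R(X)` is integral over `R̄(X)`, which is integrally closed in
    -- `S(X)` because that extension is Prüfer.
    refine hP.mem_range_of_isIntegral ⟨F.map (map R (integralClosure R S)), hF.map _, ?_⟩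
    rw [eval₂_map]
    change F.eval₂ ((map (integralClosure R S) S).comp (map R (integralClosure R S))) y = 0
    rw [map_comp_map]
    exact hFy
  · rintro ⟨z, rfl⟩
    exact isIntegral_map_integralClosure z

end NagataRing

end

/-- An extension `R ⊆ S` is Prüfer (quasi-Prüfer) if and only if `R(X) ⊆ S(X)` is. In that case
the canonical map from `R̄(X)` (`R̄` the integral closure of `R` in `S`) to `S(X)` is injective and
its image is the integral closure of `R(X)` in `S(X)`, and the canonical maps
`R̄ ⊗[R] R(X) → R̄(X)` and `S ⊗[R] R(X) → S(X)` are isomorphisms. -/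
theorem mainTheorem7 {R S : Type*} [CommRing R] [CommRing S] [Algebra R S]
    (hRS : Function.Injective (algebraMap R S)) :
    letI : Algebra (NagataRing R) (NagataRing S) := NagataRing.algebra R S
    (IsPruferExtension R S ↔ IsPruferExtension (NagataRing R) (NagataRing S)) ∧
    (IsQuasiPruferExtension R S ↔ IsQuasiPruferExtension (NagataRing R) (NagataRing S)) ∧
    (IsPruferExtension R S ∨ IsQuasiPruferExtension R S →
      Function.Injective (NagataRing.map (integralClosure R S) S) ∧
      (integralClosure (NagataRing R) (NagataRing S)).toSubring =
        (NagataRing.map (integralClosure R S) S).range ∧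
      Function.Bijective (NagataRing.tensorMap R (integralClosure R S)) ∧
      Function.Bijective (NagataRing.tensorMap R S)) := by
  let : Algebra (NagataRing R) (NagataRing S) := NagataRing.algebra R S
  refine ⟨NagataRing.isPruferExtension_iff_map hRS, NagataRing.isQuasiPruferExtension_iff_map hRS,
    fun h => ?_⟩
  have hQ : IsQuasiPruferExtension R S := h.elim IsPruferExtension.isQuasiPruferExtension id
  have hR : UnitContentDominates (algebraMap R (integralClosure R S)) :=
    unitContentDominates_of_isIntegral _ _
  have hS : UnitContentDominates (algebraMap (integralClosure R S) S) :=
    (isQuasiPruferExtension_iff.1 hQ).2.isFractionInvertible.unitContentDominates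
      Subtype.val_injective
  exact ⟨NagataRing.map_injective Subtype.val_injective, NagataRing.integralClosure_toSubring hQ,
    NagataRing.tensorMap_bijective hR, NagataRing.tensorMap_bijective (hR.comp hS)⟩
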